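/- Fix $d\ge 3$. A *bubble* is a finite connected bipartite graph (black and white vertices, multiple edges allowed) whose edges carry colors in $\{1,\dots,d\}$, each color being incident exactly once on every vertex. Inserting a *$C$-bidipole* ($C\subset\{1,\dots,d\}$, $C\neq\emptyset$, $|C|\le d/2$) at a vertex $x$ of a bubble means replacing $x$ by three vertices $v,\bar v,w$, where $v,w$ have the type (black or white) of $x$ and $\bar v$ the opposite type, $\bar v$ is joined to $w$ by the colors in $C$ and to $v$ by the colors not in $C$, and the former edges of $x$ with color in $C$ (resp. not in $C$) are attached to $v$ (resp. $w$). A *generalized melonic (GM)* bubble is one obtained from the two-vertex bubble by a sequence of such insertions; it is *totally unbalanced* if all the insertions satisfy $|C|<d/2$. Let $\{B_r\}_{r\in R}$ be a finite family of arbitrary bubbles, $b_r\ge 0$ integers and $B$ a bubble. Let $\mathbb G(\{b_r,B_r\};B)$ be the set of connected graphs obtained from a marked copy of $B$ and $b_r$ copies of $B_r$ for each $r\in R$ by adding a perfect matching of the black with the white vertices, whose edges get the color $0$. Let $L(G)=\sum_{c=1}^d L_{0c}(G)$, where $L_{0c}(G)$ is the number of bicolored cycles of $G$ with colors $\{0,c\}$,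 and let $\mathbb G_{\max}(\{b_r,B_r\};B)$ be the set of graphs maximizing $L$ over $\mathbb G(\{b_r,B_r\};B)$. Let $\mathbb G(B)$ be the set of pairings $\pi$ of the black with the white vertices of $B$ (the case without any $B_r$) and $\mathbb G_{\max}(B)$ the set of those maximizing $L$. **Theorem.** If $B$ is a totally unbalanced GM bubble, then in every $G\in\mathbb G_{\max}(\{b_r,B_r\};B)$ the marked bubble $B$ satisfies the maximal 2-cut property: there is $\pi\in\mathbb G_{\max}(B)$ such that, for every vertex $v$ of $B$, the vertices $v$ and $\pi(v)$ are either joined by an edge of color $0$ of $G$, or the two edges of color $0$ of $G$ incident to $v$ and to $\pi(v)$ form a 2-edge-cut of $G$ (deleting them disconnects $G$). -/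

import Mathlib

/-- A finite bipartite graph whose edges carry colors in `Fin d` (the colors `1, …, d`), every
color being incident exactly once on every vertex. `side` is the black/white type of a vertex and
`nbr c v` is the other end of the edge of color `c` at `v`. Multiple edges are allowed. -/
structure ColoredGraph (d : ℕ) where
  V : Type
  finite : Finite V
  side : V → Bool
  nbr : Fin d → V → V
  nbr_nbr : ∀ c v, nbr c (nbr c v) = v
  side_nbr : ∀ c v, side (nbr c v) = !side v

namespace ColoredGraph

variable {d : ℕ}

/-- Two vertices are adjacent when some edge joins them. -/
def graph (X : ColoredGraph d) : SimpleGraph X.V where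
  Adj v w := ∃ c, X.nbr c v = w
  symm := ⟨by
    rintro v w ⟨c, rfl⟩
    exact ⟨c, X.nbr_nbr c v⟩⟩
  loopless := ⟨by
    rintro v ⟨c, h⟩
    have := X.side_nbr c v
    rw [h] at this
    cases hs : X.side v <;> simp [hs] at this⟩

/-- A bubble is a connected colored graph. -/
def IsBubble (X : ColoredGraph d) : Prop := X.graph.Connected

/-- Isomorphism of colored graphs, preserving edge colors and the black/white type. -/
def Iso (X Y : ColoredGraph d) : Prop :=
  ∃ e : X.V ≃ Y.V, (∀ v, Y.side (e v) = X.side v) ∧ ∀ c v, e (X.nbr c v) = Y.nbr c (e v)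

/-- The bubble with two vertices, joined by one edge of each color. -/
def twoVertex (d : ℕ) : ColoredGraph d where
  V := Bool
  finite := inferInstance
  side := id
  nbr _ v := !v
  nbr_nbr _ v := by simp
  side_nbr _ _ := rfl

open Classical in
/-- Insertion of a `C`-bidipole `{v, v', w}` in place of the vertex `x`. The vertex `w` is written
`inl x`, `v` is `inr true` (same type as `x`) and `v'` is `inr false` (opposite type).
The vertex `v'` is joined to `w` by the colors in `C` and to `v` by the colors not in `C`;
the edges of `x` with color in `C` are attached to `v`, the others to `w`. -/
noncomputable def insertBidipole (X : ColoredGraph d) (x : X.V) (C : Finset (Fin d)) :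
    ColoredGraph d where
  V := X.V ⊕ Bool
  finite := by
    have := X.finite
    infer_instance
  side := Sum.elim X.side (fun t => if t then X.side x else !X.side x)
  nbr c := Sum.elim
    (fun y =>
      if c ∈ C then
        if y = x then Sum.inr false
        else if X.nbr c y = x then Sum.inr true
        else Sum.inl (X.nbr c y)
      else Sum.inl (X.nbr c y))
    (fun t =>
      if c ∈ C then
        if t then Sum.inl (X.nbr c x) else Sum.inl x
      else Sum.inr (!t))
  nbr_nbr c v := by
    have hne : ∀ y, X.nbr c y ≠ y := fun y h => by
      have := X.side_nbr c y
      rw [h] at this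
      cases hs : X.side y <;> simp [hs] at this
    by_cases hc : c ∈ C
    · rcases v with y | t
      · by_cases hy : y = x
        · simp [hc, hy]
        · by_cases hy' : X.nbr c y = x
          · have : X.nbr c x = y := by rw [← hy', X.nbr_nbr]
            simp [hc, hy, hy', this]
          · simp [hc, hy, hy', X.nbr_nbr]
      · cases t <;> simp [hc, hne, X.nbr_nbr]
    · rcases v with y | t
      · simp [hc, X.nbr_nbr]
      · simp [hc]
  side_nbr c v := by
    by_cases hc : c ∈ C
    · rcases v with y | t
      · by_cases hy : y = x
        · simp [hc, hy]
        · by_cases hy' : X.nbr c y = x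
          · have := X.side_nbr c y
            rw [hy'] at this
            simp [hc, hy, hy', this]
          · simp [hc, hy, hy', X.side_nbr]
      · cases t <;> simp [hc, X.side_nbr]
    · rcases v with y | t
      · simp [hc, X.side_nbr]
      · cases t <;> simp [hc]

end ColoredGraph

/-- Color sets used for bidipole insertions. As a `C`-bidipole is the same as a bidipole for the
complement of `C`, one takes `|C| ≤ d / 2`, and if `|C| = d / 2` the set that contains the first
color. The set is non-empty, as otherwise the insertion would disconnect the bubble. -/
def IsAdmissible {d : ℕ} (C : Finset (Fin d)) : Prop :=
  C.Nonempty ∧ 2 * C.card ≤ d ∧ (2 * C.card = d → ∀ i : Fin d, i.val = 0 → i ∈ C)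

namespace ColoredGraph

variable {d : ℕ}

/-- `GMBuild B 𝒞`: the graph `B` is obtained, up to isomorphism, from the bubble with two vertices
by a sequence of bidipole insertions whose color sets form the multiset `𝒞`. -/
inductive GMBuild {d : ℕ} : ColoredGraph d → Multiset (Finset (Fin d)) → Prop
  | base : GMBuild (twoVertex d) 0
  | insert (X : ColoredGraph d) (𝒞 : Multiset (Finset (Fin d))) (x : X.V) (C : Finset (Fin d)) :
      GMBuild X 𝒞 → IsAdmissible C → GMBuild (X.insertBidipole x C) (C ::ₘ 𝒞)
  | iso (X Y : ColoredGraph d) (𝒞 : Multiset (Finset (Fin d))) :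
      GMBuild X 𝒞 → X.Iso Y → GMBuild Y 𝒞

/-- Totally unbalanced generalized melonic (GM) bubbles: those built from the bubble with two
vertices by bidipole insertions all of whose color sets satisfy `|C| < d / 2`. -/
def IsTotallyUnbalancedGM (B : ColoredGraph d) : Prop :=
  ∃ 𝒞, GMBuild B 𝒞 ∧ ∀ C ∈ 𝒞, 2 * C.card < d

/-- A Wick contraction: a perfect matching of black with white vertices, by edges of color 0. -/
structure WickContraction (X : ColoredGraph d) where
  pair : X.V → X.V
  pair_pair : ∀ v, pair (pair v) = v
  side_pair : ∀ v, X.side (pair v) = !X.side v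

namespace WickContraction

variable {X : ColoredGraph d}

/-- The graph formed by the edges of `X` and those edges of color 0 that are incident to no
vertex of `S`; that is, the edges of color 0 at the vertices of `S` are deleted. -/
def deleteAt (ω : WickContraction X) (S : Set X.V) : SimpleGraph X.V where
  Adj v w := (∃ c, X.nbr c v = w) ∨ (ω.pair v = w ∧ v ∉ S ∧ w ∉ S)
  symm := ⟨by
    rintro v w (⟨c, rfl⟩ | ⟨rfl, hv, hw⟩)
    · exact Or.inl ⟨c, X.nbr_nbr c v⟩
    · exact Or.inr ⟨ω.pair_pair v, hw, hv⟩⟩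
  loopless := ⟨by
    rintro v (⟨c, h⟩ | ⟨h, -, -⟩)
    · have := X.side_nbr c v
      rw [h] at this
      cases hs : X.side v <;> simp [hs] at this
    · have := ω.side_pair v
      rw [h] at this
      cases hs : X.side v <;> simp [hs] at this⟩

/-- The contraction yields a connected graph (all edges of all colors `0, 1, …, d`). -/
def IsConnected (ω : WickContraction X) : Prop := (ω.deleteAt ∅).Connected

/-- The subgraph formed by the edges of colors `0` and `c`. -/
def bicolored (ω : WickContraction X) (c : Fin d) : SimpleGraph X.V where
  Adj v w := X.nbr c v = w ∨ ω.pair v = w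
  symm := ⟨by
    rintro v w (rfl | rfl)
    · exact Or.inl (X.nbr_nbr c v)
    · exact Or.inr (ω.pair_pair v)⟩
  loopless := ⟨by
    rintro v (h | h)
    · have := X.side_nbr c v
      rw [h] at this
      cases hs : X.side v <;> simp [hs] at this
    · have := ω.side_pair v
      rw [h] at this
      cases hs : X.side v <;> simp [hs] at this⟩

/-- The total number of bicolored cycles with colors `{0, c}`, over all `c`. These cycles are
the connected components of the subgraphs with colors `{0, c}`. -/
noncomputable def numCycles (ω : WickContraction X) : ℕ :=
  ∑ c : Fin d, Nat.card (ω.bicolored c).ConnectedComponent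

/-- The contraction is connected and has the largest number of bicolored cycles among all
connected contractions of the same collection of bubbles. -/
def IsMax (ω : WickContraction X) : Prop :=
  ω.IsConnected ∧ ∀ ω' : WickContraction X, ω'.IsConnected → ω'.numCycles ≤ ω.numCycles

end WickContraction

/-- The disjoint union of a marked copy of `B` (the left summand) and of `b r` copies of `Br r`
for every `r`. -/
def withMarked {R : Type} [Finite R] (B : ColoredGraph d) (Br : R → ColoredGraph d)
    (b : R → ℕ) : ColoredGraph d where
  V := B.V ⊕ (Σ r, Fin (b r) × (Br r).V)
  finite := by
    have := B.finite
    have := fun r => (Br r).finite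
    infer_instance
  side := Sum.elim B.side (fun p => (Br p.1).side p.2.2)
  nbr c := Sum.elim (fun v => Sum.inl (B.nbr c v))
    (fun p => Sum.inr ⟨p.1, p.2.1, (Br p.1).nbr c p.2.2⟩)
  nbr_nbr c v := by
    rcases v with v | ⟨r, i, v⟩ <;> simp [nbr_nbr]
  side_nbr c v := by
    rcases v with v | ⟨r, i, v⟩ <;> simp [side_nbr]

/-- The maximal 2-cut property of the marked copy of `B`: there is a pairing `π` of the vertices
of `B`, maximizing the number of bicolored cycles among the pairings of `B`, such that for every
pair `{v, π v}` the vertices `v` and `π v` are joined by an edge of color 0, or the two edges of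
color 0 incident to them form a 2-edge-cut of the whole graph. -/
def MaximalTwoCut {R : Type} [Finite R] {B : ColoredGraph d} {Br : R → ColoredGraph d}
    {b : R → ℕ} (G : WickContraction (withMarked B Br b)) : Prop :=
  ∃ π : WickContraction B, π.IsMax ∧ ∀ v : B.V,
    G.pair (Sum.inl v) = Sum.inl (π.pair v) ∨
      ¬ (G.deleteAt {Sum.inl v, Sum.inl (π.pair v)}).Connected

end ColoredGraph

/-! The argument is an induction on the insertions that build $B$, carried by an exchange of two
edges of color 0. Let $K$ be the number of connected components. Given $a$, $b$ of opposite types, a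
switch replaces the 0-edges $a\,a'$ and $b\,b'$ by $a\,b$ and $a'\,b'$; it lowers each $L_{0c}$ by
at most one. Merging components by switches therefore never lowers $L-dK$, so a connected maximizer
of $L$ also maximizes $L-dK$ among all contractions, connected or not (`IsMax.isPenalizedMax`). This
larger class is what the induction needs, since its switches disconnect the graph.

Let $v,\bar v$ be the vertices of an inserted bidipole that are joined by the colors outside $C$,
and suppose that they are not joined by color 0. Switching to join them gains a cycle for every
color outside $C$ and loses at most one for every color in $C$, so $L$ grows by at least $d-2|C|>0$.
Maximality of $L-dK$ then forces $K$ to grow, necessarily by exactly one: the two 0-edges form a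
cut. Such a cut makes every one of the $d$ colors gain a cycle, so $L-dK$ has not decreased and the
switched contraction is again maximal (`Switch.isPenalizedMax`).

Once $v,\bar v$ are joined by color 0, removing them turns the inserted bubble back into the
previous one, changes $L$ by a constant and keeps $K$; maximality descends and the induction
hypothesis applies. Its conclusions are then carried back through the switch
(`IsCutPairing.insertPair`). The induction must range over all ambient graphs containing the bubble
(`IsCutPairing`), because removal alters the ambient graph.

The resulting pairing $\pi$ is itself maximal: taking $B$ alone as the ambient graph, no deletion of
0-edges disconnects it, so every maximizer equals $\pi$ (`IsCutPairing.isMax`). -/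

namespace SimpleGraph

/-! ### Counting connected components when edges are added -/

variable {V W : Type*}

/-- A map that sends adjacent vertices to reachable ones preserves reachability. -/
theorem Reachable.of_adj_reachable {H : SimpleGraph V} {H' : SimpleGraph W} (f : V → W)
    (h : ∀ v w, H.Adj v w → H'.Reachable (f v) (f w)) {v w : V} (hvw : H.Reachable v w) :
    H'.Reachable (f v) (f w) := by
  obtain ⟨p⟩ := hvw
  induction p with
  | nil => exact Reachable.refl _
  | cons hadj _ ih => exact (h _ _ hadj).trans ih

/-- The map induced on connected components by a map sending adjacent vertices to reachable
ones. -/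
def ConnectedComponent.mapOfAdjReachable {H : SimpleGraph V} {H' : SimpleGraph W} (f : V → W)
    (h : ∀ v w, H.Adj v w → H'.Reachable (f v) (f w)) :
    H.ConnectedComponent → H'.ConnectedComponent :=
  Quot.map f fun _ _ hvw => Reachable.of_adj_reachable f h hvw

theorem ConnectedComponent.mapOfAdjReachable_mk {H : SimpleGraph V} {H' : SimpleGraph W}
    (f : V → W) (h : ∀ v w, H.Adj v w → H'.Reachable (f v) (f w)) (v : V) :
    mapOfAdjReachable f h (H.connectedComponentMk v) = H'.connectedComponentMk (f v) := rfl

theorem ConnectedComponent.mapOfAdjReachable_id_surjective {H H' : SimpleGraph V}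
    (h : ∀ v w, H.Adj v w → H'.Reachable v w) :
    Function.Surjective (mapOfAdjReachable (H := H) (H' := H') id h) := by
  intro C
  induction C using ConnectedComponent.ind with
  | _ v => exact ⟨H.connectedComponentMk v, rfl⟩

theorem card_connectedComponent_le [Finite V] {H H' : SimpleGraph V}
    (h : ∀ v w, H.Adj v w → H'.Reachable v w) :
    Nat.card H'.ConnectedComponent ≤ Nat.card H.ConnectedComponent :=
  Nat.card_le_card_of_surjective _ (ConnectedComponent.mapOfAdjReachable_id_surjective h)

theorem card_connectedComponent_lt [Finite V] {H H' : SimpleGraph V}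
    (h : ∀ v w, H.Adj v w → H'.Reachable v w) {a b : V} (hab : H'.Reachable a b)
    (hab' : ¬ H.Reachable a b) :
    Nat.card H'.ConnectedComponent < Nat.card H.ConnectedComponent := by
  have hs := ConnectedComponent.mapOfAdjReachable_id_surjective h
  refine lt_of_le_of_ne (Nat.card_le_card_of_surjective _ hs) fun he => hab' ?_
  have hb := (Nat.bijective_iff_surjective_and_card _).2 ⟨hs, he.symm⟩
  refine ConnectedComponent.exact (hb.1 ?_)
  exact ConnectedComponent.sound hab

theorem reachable_sup_edge {H : SimpleGraph V} {a b v w : V}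
    (h : (H ⊔ edge a b).Reachable v w) :
    H.Reachable v w ∨ ((H.Reachable v a ∨ H.Reachable v b) ∧
      (H.Reachable w a ∨ H.Reachable w b)) := by
  obtain ⟨p⟩ := h
  induction p with
  | nil => exact Or.inl (Reachable.refl _)
  | @cons x y z hadj _ ih =>
    rcases hadj with hadj | hadj
    · have hxy := hadj.reachable
      rcases ih with ih | ⟨ih | ih, ih'⟩
      · exact Or.inl (hxy.trans ih)
      · exact Or.inr ⟨Or.inl (hxy.trans ih), ih'⟩
      · exact Or.inr ⟨Or.inr (hxy.trans ih), ih'⟩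
    · rw [edge_adj] at hadj
      right
      rcases hadj.1 with ⟨rfl, rfl⟩ | ⟨rfl, rfl⟩
      · refine ⟨Or.inl (Reachable.refl _), ?_⟩
        rcases ih with ih | ih
        · exact Or.inr ih.symm
        · exact ih.2
      · refine ⟨Or.inr (Reachable.refl _), ?_⟩
        rcases ih with ih | ih
        · exact Or.inl ih.symm
        · exact ih.2

/-- A new edge can only merge the components of its two ends; once the component of `a` is set aside
as `none`, the others remain distinct. -/
theorem card_connectedComponent_le_sup_edge [Finite V] (H : SimpleGraph V) (a b : V) :
    Nat.card H.ConnectedComponent ≤ Nat.card (H ⊔ edge a b).ConnectedComponent + 1 := by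
  classical
  have hle : ∀ v w, H.Adj v w → (H ⊔ edge a b).Reachable v w :=
    fun v w h => Adj.reachable (Or.inl h)
  let φ : H.ConnectedComponent → Option (H ⊔ edge a b).ConnectedComponent := fun C =>
    if C = H.connectedComponentMk a then none
    else some (ConnectedComponent.mapOfAdjReachable id hle C)
  have hφ : Function.Injective φ := by
    intro C D
    induction C using ConnectedComponent.ind with | _ v => ?_
    induction D using ConnectedComponent.ind with | _ w => ?_
    intro h
    by_cases hv : H.connectedComponentMk v = H.connectedComponentMk a <;>
      by_cases hw : H.connectedComponentMk w = H.connectedComponentMk a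
    · rw [hv, hw]
    · simp [φ, hv, hw] at h
    · simp [φ, hv, hw] at h
    · simp only [φ, hv, hw, if_false, Option.some.injEq,
        ConnectedComponent.mapOfAdjReachable_mk, id] at h
      rw [ConnectedComponent.eq] at hv hw h ⊢
      rcases reachable_sup_edge h with h | ⟨h | h, h' | h'⟩
      · exact h
      · exact absurd h hv
      · exact absurd h hv
      · exact absurd h' hw
      · exact h.trans h'.symm
  have := Nat.card_le_card_of_injective φ hφ
  rwa [Finite.card_option] at this

theorem card_connectedComponent_le_add_one [Finite V] {H H' : SimpleGraph V} {a b : V}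
    (h : ∀ v w, H'.Adj v w → (H ⊔ edge a b).Reachable v w) :
    Nat.card H.ConnectedComponent ≤ Nat.card H'.ConnectedComponent + 1 :=
  (card_connectedComponent_le_sup_edge H a b).trans
    (Nat.add_le_add_right (card_connectedComponent_le h) 1)

theorem reachable_sup_edge_ends (H : SimpleGraph V) (a b : V) :
    (H ⊔ edge a b).Reachable a b := by
  by_cases h : a = b
  · rw [h]
  · exact Adj.reachable (Or.inr (by simp [edge_adj, h]))

theorem connected_iff_card [Finite V] (H : SimpleGraph V) :
    H.Connected ↔ Nat.card H.ConnectedComponent = 1 := by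
  rw [Nat.card_eq_one_iff_unique, SimpleGraph.connected_iff]
  refine and_congr ⟨fun h => h.subsingleton_connectedComponent, fun h v w => ?_⟩
    ⟨fun ⟨v⟩ => ⟨H.connectedComponentMk v⟩, fun ⟨C⟩ => ?_⟩
  · exact ConnectedComponent.exact (Subsingleton.elim _ _)
  · induction C using ConnectedComponent.ind with | _ v => exact ⟨v⟩

end SimpleGraph

/-! ### Subgraphs of a contraction and black/white parity -/

namespace ColoredGraph

variable {d : ℕ}

instance (X : ColoredGraph d) : Finite X.V := X.finite

namespace WickContraction

variable {X : ColoredGraph d}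

theorem ext_pair {ω ω' : WickContraction X} (h : ∀ v, ω.pair v = ω'.pair v) : ω = ω' := by
  cases ω; cases ω'
  congr
  exact funext h

/-- The subgraph formed by the edges with colors in `T` and by the edges of color 0 that are
incident to no vertex of `S`. -/
def sub (ω : WickContraction X) (T : Set (Fin d)) (S : Set X.V) : SimpleGraph X.V where
  Adj v w := (∃ c ∈ T, X.nbr c v = w) ∨ (ω.pair v = w ∧ v ∉ S ∧ w ∉ S)
  symm := ⟨by
    rintro v w (⟨c, hc, rfl⟩ | ⟨rfl, hv, hw⟩)
    · exact Or.inl ⟨c, hc, X.nbr_nbr c v⟩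
    · exact Or.inr ⟨ω.pair_pair v, hw, hv⟩⟩
  loopless := ⟨by
    rintro v (⟨c, -, h⟩ | ⟨h, -, -⟩)
    · have := X.side_nbr c v
      rw [h] at this
      cases hs : X.side v <;> simp [hs] at this
    · have := ω.side_pair v
      rw [h] at this
      cases hs : X.side v <;> simp [hs] at this⟩

/-- The number of connected components of `sub`. -/
noncomputable def count (ω : WickContraction X) (T : Set (Fin d)) (S : Set X.V) : ℕ :=
  Nat.card (ω.sub T S).ConnectedComponent

theorem deleteAt_eq_sub (ω : WickContraction X) (S : Set X.V) :
    ω.deleteAt S = ω.sub Set.univ S := by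
  ext v w
  simp [deleteAt, sub]

theorem bicolored_eq_sub (ω : WickContraction X) (c : Fin d) :
    ω.bicolored c = ω.sub {c} ∅ := by
  ext v w
  simp [bicolored, sub]

theorem numCycles_eq (ω : WickContraction X) : ω.numCycles = ∑ c, ω.count {c} ∅ := by
  simp only [numCycles, count, bicolored_eq_sub]

theorem isConnected_iff (ω : WickContraction X) :
    ω.IsConnected ↔ ω.count Set.univ ∅ = 1 := by
  rw [IsConnected, deleteAt_eq_sub, SimpleGraph.connected_iff_card, count]

theorem pair_ne_of_side_eq (ω : WickContraction X) {v w : X.V} (h : X.side v = X.side w) :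
    ω.pair v ≠ w := by
  rintro rfl
  rw [ω.side_pair] at h
  cases hs : X.side v <;> simp [hs] at h

theorem sub_nbr (ω : WickContraction X) {T : Set (Fin d)} (S : Set X.V) {c : Fin d}
    (hc : c ∈ T) (v : X.V) : (ω.sub T S).Reachable v (X.nbr c v) :=
  SimpleGraph.Adj.reachable (Or.inl ⟨c, hc, rfl⟩)

theorem sub_pair (ω : WickContraction X) (T : Set (Fin d)) {S : Set X.V} {v : X.V}
    (hv : v ∉ S) (hv' : ω.pair v ∉ S) : (ω.sub T S).Reachable v (ω.pair v) :=
  SimpleGraph.Adj.reachable (Or.inr ⟨rfl, hv, hv'⟩)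

/-- In a union of components of `sub`, the vertices where the edge of color 0 has been deleted are
balanced between black and white. -/
theorem exists_opposite_reachable (ω : WickContraction X) {T : Set (Fin d)} (hT : T.Nonempty)
    {S : Set X.V} (hS : ∀ v ∈ S, ω.pair v ∈ S) {a : X.V} (ha : a ∈ S) :
    ∃ v ∈ S, X.side v = !X.side a ∧ (ω.sub T S).Reachable a v := by
  classical
  obtain ⟨c, hc⟩ := hT
  have := Fintype.ofFinite X.V
  let H := ω.sub T S
  let sgn : X.V → ℤ := fun v => if X.side v = X.side a then 1 else -1
  have hsgn : ∀ v w, X.side w = !X.side v → sgn v + sgn w = 0 := by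
    intro v w h
    simp only [sgn, h]
    cases X.side v <;> cases X.side a <;> simp
  have hne : ∀ v w, X.side w = !X.side v → w ≠ v := by
    rintro v w h rfl
    cases hs : X.side w <;> simp [hs] at h
  -- Count the component of `a` with sign by type. Color `c` matches the whole component, and color
  -- 0 matches its part outside `S`; both signed counts vanish, hence so does that of its part in
  -- `S`.
  let U : Finset X.V := Finset.univ.filter fun v => H.Reachable a v
  have h1 : ∑ v ∈ U, sgn v = 0 := by
    refine Finset.sum_involution (fun v _ => X.nbr c v) (fun v _ => hsgn _ _ (X.side_nbr c v))
      (fun v _ _ => hne _ _ (X.side_nbr c v)) (fun v hv => ?_) (fun v _ => X.nbr_nbr c v)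
    simp only [U, Finset.mem_filter, Finset.mem_univ, true_and] at hv ⊢
    exact hv.trans (ω.sub_nbr S hc v)
  have h2 : ∑ v ∈ U.filter (· ∉ S), sgn v = 0 := by
    refine Finset.sum_involution (fun v _ => ω.pair v) (fun v _ => hsgn _ _ (ω.side_pair v))
      (fun v _ _ => hne _ _ (ω.side_pair v)) (fun v hv => ?_) (fun v _ => ω.pair_pair v)
    simp only [U, Finset.mem_filter, Finset.mem_univ, true_and] at hv ⊢
    have hv' : ω.pair v ∉ S := fun h => hv.2 (by simpa [ω.pair_pair] using hS _ h)
    exact ⟨hv.1.trans (ω.sub_pair T hv.2 hv'), hv'⟩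
  have h3 : ∑ v ∈ U.filter (· ∈ S), sgn v = 0 := by
    have := Finset.sum_filter_add_sum_filter_not U (· ∈ S) sgn
    rw [h1, h2, add_zero] at this
    exact this
  by_contra! hcon
  have h4 : ∑ v ∈ U.filter (· ∈ S), sgn v = ((U.filter (· ∈ S)).card : ℤ) := by
    rw [Finset.card_eq_sum_ones, Nat.cast_sum]
    refine Finset.sum_congr rfl fun v hv => ?_
    simp only [U, Finset.mem_filter, Finset.mem_univ, true_and] at hv
    have : X.side v = X.side a := by
      by_contra hne
      refine hcon v hv.2 ?_ hv.1
      cases h : X.side v <;> cases h' : X.side a <;> simp_all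
    simp [sgn, this]
  have h5 : a ∈ U.filter (· ∈ S) := by simp [U, ha]
  have h6 := Finset.card_pos.2 ⟨a, h5⟩
  omega

/-- The contraction conjugated by the exchange of two vertices of the same type. -/
def conj [DecidableEq X.V] (ω : WickContraction X) (x y : X.V) (h : X.side x = X.side y) :
    WickContraction X where
  pair v := Equiv.swap x y (ω.pair (Equiv.swap x y v))
  pair_pair v := by simp [ω.pair_pair]
  side_pair v := by
    have hs : ∀ v, X.side (Equiv.swap x y v) = X.side v := by
      intro v
      rw [Equiv.swap_apply_def]
      split_ifs with h1 h2
      · rw [h1, h]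
      · rw [h2, h]
      · rfl
    rw [hs, ω.side_pair, hs]

/-! ### Switches and their effect on component counts -/

/-- `ω'` is obtained from `ω` by exchanging the edges of color 0 at `a` and `b` with edges from
`a` to `b` and from `ω.pair a` to `ω.pair b`. -/
structure Switch (ω ω' : WickContraction X) (a b : X.V) : Prop where
  opp : X.side b = !X.side a
  ne : ω.pair a ≠ b
  left : ω'.pair a = b
  right : ω'.pair (ω.pair a) = ω.pair b
  other : ∀ v, v ≠ a → v ≠ b → v ≠ ω.pair a → v ≠ ω.pair b → ω'.pair v = ω.pair v

theorem exists_switch (ω : WickContraction X) {a b : X.V} (h : X.side b = !X.side a)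
    (hne : ω.pair a ≠ b) : ∃ ω', Switch ω ω' a b := by
  classical
  have hs : X.side b = X.side (ω.pair a) := by rw [h, ω.side_pair]
  have hab : a ≠ b := by
    rintro rfl
    cases hs : X.side a <;> simp [hs] at h
  have hapa : a ≠ ω.pair a := (ω.pair_ne_of_side_eq rfl).symm
  have hbpb : ω.pair b ≠ b := ω.pair_ne_of_side_eq rfl
  have hpp : ω.pair b ≠ ω.pair a := ω.pair_ne_of_side_eq hs
  -- Exchanging `b` with the partner of `a`, which has the same type, is exactly the switch.
  refine ⟨ω.conj b (ω.pair a) hs, h, hne, ?_, ?_, fun v h1 h2 h3 h4 => ?_⟩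
  · simp only [conj]
    rw [Equiv.swap_apply_of_ne_of_ne hab hapa, Equiv.swap_apply_right]
  · simp only [conj]
    rw [Equiv.swap_apply_right, Equiv.swap_apply_of_ne_of_ne hbpb hpp]
  · simp only [conj]
    rw [Equiv.swap_apply_of_ne_of_ne h2 h3, Equiv.swap_apply_of_ne_of_ne]
    · rintro rfl
      exact h4 (ω.pair_pair v).symm
    · intro hv
      exact h1 (by rw [← ω.pair_pair v, hv, ω.pair_pair])

namespace Switch

variable {ω ω' : WickContraction X} {a b : X.V}

/-- The four vertices where the color 0 edges change. -/
def ends (ω : WickContraction X) (a b : X.V) : Set X.V := {a, b, ω.pair a, ω.pair b}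

theorem left' (h : Switch ω ω' a b) : ω'.pair b = a := by rw [← h.left, ω'.pair_pair]

theorem right' (h : Switch ω ω' a b) : ω'.pair (ω.pair b) = ω.pair a := by
  rw [← h.right, ω'.pair_pair]

theorem ends_closed (v : X.V) (hv : v ∈ ends ω a b) : ω.pair v ∈ ends ω a b := by
  rcases hv with rfl | rfl | rfl | rfl <;> simp [ends, ω.pair_pair]

theorem sub_ends_eq (h : Switch ω ω' a b) (T : Set (Fin d)) :
    ω'.sub T (ends ω a b) = ω.sub T (ends ω a b) := by
  ext v w
  have : v ∉ ends ω a b → ω'.pair v = ω.pair v := by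
    intro hv
    simp only [ends, Set.mem_insert_iff, Set.mem_singleton_iff, not_or] at hv
    exact h.other v hv.1 hv.2.1 hv.2.2.1 hv.2.2.2
  simp only [sub]
  refine or_congr_right ⟨fun ⟨h1, h2, h3⟩ => ⟨this h2 ▸ h1, h2, h3⟩,
    fun ⟨h1, h2, h3⟩ => ⟨(this h2).symm ▸ h1, h2, h3⟩⟩

/-- To compare the graph of `ω` with another graph, only the two exchanged edges matter. -/
theorem adj_reachable {T : Set (Fin d)} {H : SimpleGraph X.V}
    (hM : ∀ v w, (ω.sub T (ends ω a b)).Adj v w → H.Reachable v w)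
    (ha : H.Reachable a (ω.pair a)) (hb : H.Reachable b (ω.pair b)) (S : Set X.V) (v w : X.V)
    (hvw : (ω.sub T S).Adj v w) : H.Reachable v w := by
  rcases hvw with hc | ⟨rfl, -, -⟩
  · exact hM v w (Or.inl hc)
  · by_cases hv : v ∈ ends ω a b
    · rcases hv with rfl | rfl | rfl | rfl
      · exact ha
      · exact hb
      · rw [ω.pair_pair]; exact ha.symm
      · rw [ω.pair_pair]; exact hb.symm
    · refine hM _ _ (Or.inr ⟨rfl, hv, fun h => hv ?_⟩)
      simpa [ω.pair_pair] using ends_closed _ h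

theorem adj_reachable' (h : Switch ω ω' a b) {T : Set (Fin d)} {H : SimpleGraph X.V}
    (hM : ∀ v w, (ω.sub T (ends ω a b)).Adj v w → H.Reachable v w)
    (ha : H.Reachable a b) (hb : H.Reachable (ω.pair a) (ω.pair b)) (S : Set X.V) (v w : X.V)
    (hvw : (ω'.sub T S).Adj v w) : H.Reachable v w := by
  have he : ends ω' a (ω.pair a) = ends ω a b := by
    ext z
    simp only [ends, h.left, h.right, Set.mem_insert_iff, Set.mem_singleton_iff]
    tauto
  refine adj_reachable (ω := ω') (a := a) (b := ω.pair a) ?_ (by rwa [h.left]) (by rwa [h.right])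
    S v w hvw
  rw [he, h.sub_ends_eq]
  exact hM

theorem sub_ends_le (ω : WickContraction X) (a b : X.V) (T : Set (Fin d)) (v w : X.V)
    (h : (ω.sub T (ends ω a b)).Adj v w) : (ω.sub T ∅).Reachable v w :=
  SimpleGraph.Adj.reachable (h.imp_right fun h => ⟨h.1, id, id⟩)

/-- Among the four ends only `b` and `ω.pair a` have the type opposite to `a`, so parity leaves
these two possibilities. -/
theorem parity_left (h : Switch ω ω' a b) {T : Set (Fin d)} (hT : T.Nonempty) :
    (ω.sub T (ends ω a b)).Reachable a b ∨
      (ω.sub T (ends ω a b)).Reachable a (ω.pair a) := by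
  obtain ⟨v, hv, hs, hr⟩ := ω.exists_opposite_reachable hT (ends_closed (ω := ω) (a := a) (b := b))
    (a := a) (by simp [ends])
  rcases hv with rfl | rfl | rfl | rfl
  · cases h : X.side v <;> simp [h] at hs
  · exact Or.inl hr
  · exact Or.inr hr
  · rw [ω.side_pair, h.opp] at hs
    cases h : X.side a <;> simp [h] at hs

theorem symm (h : Switch ω ω' a b) : Switch ω ω' b a where
  opp := by rw [h.opp, Bool.not_not]
  ne := fun hb => h.ne (by rw [← hb, ω.pair_pair])
  left := h.left'
  right := h.right'
  other v h1 h2 h3 h4 := h.other v h2 h1 h4 h3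

theorem dual (h : Switch ω ω' a b) : Switch ω ω' (ω.pair a) (ω.pair b) where
  opp := by rw [ω.side_pair, ω.side_pair, h.opp]
  ne := fun hb => h.symm.ne (by rw [← hb, ω.pair_pair])
  left := h.right
  right := by rw [ω.pair_pair, ω.pair_pair, h.left]
  other v h1 h2 h3 h4 := by
    rw [ω.pair_pair] at h3 h4
    exact h.other v h3 h4 h1 h2

theorem ends_dual : ends ω (ω.pair a) (ω.pair b) = ends ω a b := by
  ext z
  simp only [ends, ω.pair_pair, Set.mem_insert_iff, Set.mem_singleton_iff]
  tauto

theorem ends_symm : ends ω b a = ends ω a b := by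
  ext z
  simp only [ends, Set.mem_insert_iff, Set.mem_singleton_iff]
  tauto

theorem parity_right (h : Switch ω ω' a b) {T : Set (Fin d)} (hT : T.Nonempty) :
    (ω.sub T (ends ω a b)).Reachable (ω.pair a) (ω.pair b) ∨
      (ω.sub T (ends ω a b)).Reachable (ω.pair a) a := by
  have := h.dual.parity_left hT
  rwa [ends_dual, ω.pair_pair] at this

theorem parity_right' (h : Switch ω ω' a b) {T : Set (Fin d)} (hT : T.Nonempty) :
    (ω.sub T (ends ω a b)).Reachable (ω.pair b) (ω.pair a) ∨
      (ω.sub T (ends ω a b)).Reachable (ω.pair b) b := by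
  have := h.symm.parity_right hT
  rwa [ends_symm] at this

/-- Delete the two old edges, which cannot lower the count, then add the two new ones. By parity,
one of the new edges already makes the other redundant, so at most one merger occurs. -/
theorem count_le_add_one (h : Switch ω ω' a b) {T : Set (Fin d)} (hT : T.Nonempty) :
    ω.count T ∅ ≤ ω'.count T ∅ + 1 := by
  have h1 : ω.count T ∅ ≤ ω.count T (ends ω a b) :=
    SimpleGraph.card_connectedComponent_le (sub_ends_le ω a b T)
  refine h1.trans ?_
  set M := ω.sub T (ends ω a b) with hM
  have hle : ∀ {x y v w : X.V}, M.Reachable v w → (M ⊔ SimpleGraph.edge x y).Reachable v w :=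
    fun h => h.mono le_sup_left
  rcases h.parity_left hT with hab | haa
  · refine SimpleGraph.card_connectedComponent_le_add_one (a := ω.pair a) (b := ω.pair b) ?_
    exact h.adj_reachable' (fun v w h => hle h.reachable) (hle hab)
      (SimpleGraph.reachable_sup_edge_ends _ _ _) ∅
  · have hE := SimpleGraph.reachable_sup_edge_ends M a b
    refine SimpleGraph.card_connectedComponent_le_add_one (a := a) (b := b) ?_
    refine h.adj_reachable' (fun v w h => hle h.reachable) hE ?_ ∅
    rcases h.parity_right' hT with hb | hb
    · exact hle hb.symm
    · exact (hle haa.symm).trans (hE.trans (hle hb.symm))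

/-- If the old edge at `a` is a bridge once both old edges are deleted, parity connects `a` to `b`
and their partners to each other. The new edges then merge nothing, whereas the old ones did. -/
theorem count_lt (h : Switch ω ω' a b) {T : Set (Fin d)} (hT : T.Nonempty)
    (hn : ¬ (ω.sub T (ends ω a b)).Reachable a (ω.pair a)) :
    ω.count T ∅ < ω'.count T ∅ := by
  have hab := (h.parity_left hT).resolve_right hn
  have hpp := (h.parity_right hT).resolve_right fun h => hn h.symm
  refine lt_of_lt_of_le (b := ω.count T (ends ω a b)) ?_ ?_
  · exact SimpleGraph.card_connectedComponent_lt (sub_ends_le ω a b T)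
      (ω.sub_pair T (by simp) (by simp)) hn
  · exact SimpleGraph.card_connectedComponent_le
      (h.adj_reachable' (fun v w h => h.reachable) hab hpp ∅)

theorem count_lt_of_nbr (h : Switch ω ω' a b) {c : Fin d} (hc : X.nbr c a = b) :
    ω.count {c} ∅ < ω'.count {c} ∅ := by
  refine h.count_lt (Set.singleton_nonempty c) fun hr => ?_
  -- With their 0-edges deleted, `a` and `b` form a component by themselves in color `c`.
  have key : ∀ v w, (ω.sub {c} (ends ω a b)).Reachable v w → (v = a ∨ v = b) → (w = a ∨ w = b) := by
    rintro v w ⟨p⟩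
    induction p with
    | nil => exact id
    | cons hadj _ ih =>
      intro hv
      refine ih ?_
      rcases hadj with ⟨c', rfl, rfl⟩ | ⟨-, h2, -⟩
      · rcases hv with rfl | rfl
        · exact Or.inr hc
        · exact Or.inl (by rw [← hc, X.nbr_nbr])
      · exact absurd (by rcases hv with rfl | rfl <;> simp [ends]) h2
  rcases key _ _ hr (Or.inl rfl) with h1 | h1
  · exact ω.pair_ne_of_side_eq rfl h1
  · exact h.ne h1

/-- Merging two components by a switch. -/
theorem count_lt_of_not_reachable (h : Switch ω ω' a b) {T : Set (Fin d)} (hT : T.Nonempty)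
    (hn : ¬ (ω.sub T ∅).Reachable a b) : ω'.count T ∅ < ω.count T ∅ := by
  have hM : ∀ {v w}, (ω.sub T (ends ω a b)).Reachable v w → (ω.sub T ∅).Reachable v w :=
    fun hr => hr.of_adj_reachable id (sub_ends_le ω a b T)
  have hM' : ∀ v w, (ω.sub T (ends ω a b)).Adj v w → (ω'.sub T ∅).Reachable v w := by
    intro v w hvw
    rw [← h.sub_ends_eq] at hvw
    exact SimpleGraph.Adj.reachable (hvw.imp_right fun h => ⟨h.1, id, id⟩)
  -- As `a` and `b` lie in different components, parity leaves each end connected to its old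
  -- partner; the switch separates nothing and joins `a` to `b`.
  have haa := (h.parity_left hT).resolve_left fun hr => hn (hM hr)
  have hbb := h.symm.parity_left hT
  rw [ends_symm] at hbb
  replace hbb := hbb.resolve_left fun hr => hn (hM hr).symm
  have hab : (ω'.sub T ∅).Reachable a b := by
    have := ω'.sub_pair T (v := a) (S := ∅) (by simp) (by simp)
    rwa [h.left] at this
  exact SimpleGraph.card_connectedComponent_lt
    (adj_reachable hM' (haa.of_adj_reachable id hM') (hbb.of_adj_reachable id hM') ∅) hab hn

/-- Deleting edges at vertices other than `a` and `b`, adjacent in `X`, a switch creates at most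
one component. -/
theorem count_univ_le_add_one (h : Switch ω ω' a b) {c : Fin d} (hc : X.nbr c a = b)
    {D : Set X.V} (ha : a ∉ D) (hb : b ∉ D) :
    ω'.count Set.univ D ≤ ω.count Set.univ D + 1 := by
  classical
  -- It suffices to find one extra edge `x y` which, added to the graph of `ω'`, restores both old
  -- edges whenever they survive the deletion at `D`.
  have main : ∀ x y : X.V,
      (a ∉ D → ω.pair a ∉ D → (ω'.sub Set.univ D ⊔ SimpleGraph.edge x y).Reachable a (ω.pair a)) →
      (b ∉ D → ω.pair b ∉ D → (ω'.sub Set.univ D ⊔ SimpleGraph.edge x y).Reachable b (ω.pair b)) →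
      ω'.count Set.univ D ≤ ω.count Set.univ D + 1 := by
    intro x y hA hB
    refine SimpleGraph.card_connectedComponent_le_add_one (a := x) (b := y) ?_
    rintro v w (hc | ⟨rfl, h1, h2⟩)
    · exact SimpleGraph.Adj.reachable (Or.inl (Or.inl hc))
    · by_cases hv : v ∈ ends ω a b
      · rcases hv with rfl | rfl | rfl | rfl
        · exact hA h1 h2
        · exact hB h1 h2
        · rw [ω.pair_pair] at h2 ⊢; exact (hA h2 h1).symm
        · rw [ω.pair_pair] at h2 ⊢; exact (hB h2 h1).symm
      · simp only [ends, Set.mem_insert_iff, Set.mem_singleton_iff, not_or] at hv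
        refine SimpleGraph.Adj.reachable (Or.inl (Or.inr ⟨?_, h1, h2⟩))
        exact h.other v hv.1 hv.2.1 hv.2.2.1 hv.2.2.2
  by_cases hpa : ω.pair a ∈ D
  · exact main b (ω.pair b) (fun _ h => absurd hpa h)
      fun _ _ => SimpleGraph.reachable_sup_edge_ends _ _ _
  · have hE := SimpleGraph.reachable_sup_edge_ends (ω'.sub Set.univ D) a (ω.pair a)
    -- The edge from `b` to its partner is bypassed through `a` by color `c`, the restored edge at
    -- `a`, and the new edge between the partners.
    refine main a (ω.pair a) (fun _ _ => hE) fun _ hpb => ?_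
    have h1 : (ω'.sub Set.univ D).Reachable b a := by
      rw [← hc]; exact (ω'.sub_nbr D (Set.mem_univ c) a).symm
    have h2 : (ω'.sub Set.univ D).Reachable (ω.pair a) (ω.pair b) := by
      rw [← h.right]
      exact ω'.sub_pair _ hpa (by rwa [h.right])
    exact (h1.mono le_sup_left).trans (hE.trans (h2.mono le_sup_left))

end Switch

/-! ### Penalized maximality -/

/-- Maximality of `numCycles - d * (number of components)` among all contractions, connected or
not. -/
def IsPenalizedMax (ω : WickContraction X) : Prop :=
  ∀ ω' : WickContraction X,
    ω'.numCycles + d * ω.count Set.univ ∅ ≤ ω.numCycles + d * ω'.count Set.univ ∅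

theorem IsMax.isPenalizedMax [NeZero d] {ω : WickContraction X} (hω : ω.IsMax) :
    ω.IsPenalizedMax := by
  have h1 := (isConnected_iff ω).1 hω.1
  have hne : (Set.univ : Set (Fin d)).Nonempty := ⟨0, trivial⟩
  intro ω'
  rw [h1]
  induction hn : ω'.count Set.univ ∅ using Nat.strong_induction_on generalizing ω' with
  | _ n ih =>
    subst hn
    by_cases hcon : ω'.IsConnected
    · rw [(isConnected_iff ω').1 hcon]
      have := hω.2 ω' hcon
      omega
    · have hV : Nonempty X.V := hω.1.nonempty
      have : ∃ a b, X.side b = !X.side a ∧ ¬ (ω'.sub Set.univ ∅).Reachable a b := by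
        rw [IsConnected, deleteAt_eq_sub, SimpleGraph.connected_iff] at hcon
        simp only [hV, and_true, SimpleGraph.Preconnected, not_forall] at hcon
        obtain ⟨a, b, hab⟩ := hcon
        by_cases hs : X.side b = !X.side a
        · exact ⟨a, b, hs, hab⟩
        -- If the types agree, the partner of `b` lies in the same component and has the other type.
        · refine ⟨a, ω'.pair b, ?_, fun hr => hab (hr.trans ?_)⟩
          · rw [ω'.side_pair]
            cases h : X.side a <;> cases h' : X.side b <;> simp_all
          · exact (ω'.sub_pair _ (by simp) (by simp)).symm
      obtain ⟨a, b, hs, hab⟩ := this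
      obtain ⟨ω'', hsw⟩ := ω'.exists_switch hs fun hp =>
        hab (hp ▸ ω'.sub_pair _ (by simp) (by simp))
      have hlt := hsw.count_lt_of_not_reachable hne hab
      have hL : ω'.numCycles ≤ ω''.numCycles + d := by
        rw [numCycles_eq, numCycles_eq]
        calc _ ≤ ∑ c : Fin d, (ω''.count {c} ∅ + 1) :=
              Finset.sum_le_sum fun c _ => hsw.count_le_add_one (Set.singleton_nonempty c)
          _ = _ := by simp [Finset.sum_add_distrib]
      have := ih _ hlt ω'' rfl
      nlinarith

/-- If most of the colors join `a` and `b`, joining them by a switch splits a component off and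
preserves maximality. -/
theorem Switch.isPenalizedMax {ω ω' : WickContraction X} {a b : X.V} (h : Switch ω ω' a b)
    (hω : ω.IsPenalizedMax) (C : Finset (Fin d)) (hC : 2 * C.card < d)
    (hab : ∀ c ∉ C, X.nbr c a = b) :
    ω'.count Set.univ ∅ = ω.count Set.univ ∅ + 1 ∧ ω'.IsPenalizedMax := by
  obtain ⟨c, hc⟩ : ∃ c, c ∉ C := by
    by_contra! hall
    have : C = Finset.univ := Finset.eq_univ_iff_forall.2 hall
    rw [this, Finset.card_univ, Fintype.card_fin] at hC
    omega
  have hle := h.count_univ_le_add_one (hab c hc) (D := ∅) (by simp) (by simp)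
  -- Gain one for each color outside `C`, lose at most one for each color in `C`: the net gain is at
  -- least `d - 2 * C.card`.
  have hL : ω.numCycles + d ≤ ω'.numCycles + 2 * C.card := by
    rw [numCycles_eq, numCycles_eq]
    have : ∑ c : Fin d, (ω.count {c} ∅ + 1) ≤
        ∑ c : Fin d, (ω'.count {c} ∅ + if c ∈ C then 2 else 0) := by
      refine Finset.sum_le_sum fun c _ => ?_
      split_ifs with hc
      · have := h.count_le_add_one (Set.singleton_nonempty c)
        omega
      · exact h.count_lt_of_nbr (hab c hc)
    simpa [Finset.sum_add_distrib, mul_comm] using this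
  have hK : ω'.count Set.univ ∅ = ω.count Set.univ ∅ + 1 := by
    refine le_antisymm hle ?_
    by_contra hlt
    have := hω ω'
    have : d * ω'.count Set.univ ∅ ≤ d * ω.count Set.univ ∅ :=
      Nat.mul_le_mul_left _ (by omega)
    omega
  refine ⟨hK, ?_⟩
  -- Otherwise the graph of `ω'` would still connect the ends of both old edges, and no component
  -- could have been created.
  have hn : ¬ (ω.sub Set.univ (Switch.ends ω a b)).Reachable a (ω.pair a) := by
    intro hr
    have hM' : ∀ v w, (ω.sub Set.univ (Switch.ends ω a b)).Adj v w →
        (ω'.sub Set.univ ∅).Reachable v w := by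
      intro v w hvw
      rw [← h.sub_ends_eq] at hvw
      exact SimpleGraph.Adj.reachable (hvw.imp_right fun h => ⟨h.1, id, id⟩)
    have h1 := hr.of_adj_reachable id hM'
    have h2 : (ω'.sub Set.univ ∅).Reachable a b := by
      rw [← hab c hc]; exact ω'.sub_nbr ∅ (Set.mem_univ c) a
    have h3 : (ω'.sub Set.univ ∅).Reachable (ω.pair a) (ω.pair b) := by
      rw [← h.right]; exact ω'.sub_pair _ (by simp) (by simp)
    have : ω'.count Set.univ ∅ ≤ ω.count Set.univ ∅ :=
      SimpleGraph.card_connectedComponent_le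
        (Switch.adj_reachable hM' h1 (h2.symm.trans (h1.trans h3)) ∅)
    omega
  -- Separation using all colors implies separation in each single color, so the colors in `C` gain
  -- a cycle too; this pays for the penalty of the new component.
  have hL' : ω.numCycles + d ≤ ω'.numCycles := by
    rw [numCycles_eq, numCycles_eq]
    have : ∑ c : Fin d, (ω.count {c} ∅ + 1) ≤ ∑ c : Fin d, ω'.count {c} ∅ := by
      refine Finset.sum_le_sum fun c _ => h.count_lt (Set.singleton_nonempty c) fun hr => hn ?_
      refine hr.mono fun v w hvw => ?_
      exact hvw.imp_left fun ⟨c, _, hc⟩ => ⟨c, trivial, hc⟩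
    simpa [Finset.sum_add_distrib] using this
  intro ω''
  have := hω ω''
  rw [hK]
  nlinarith

/-- Without its 0-edges at `a` and `b`, the graph of `ω` is a subgraph of that of `ω'`. A component
created by the switch thus shows that these two edges form a cut. -/
theorem Switch.count_deleteAt_ends {ω ω' : WickContraction X} {a b : X.V} (h : Switch ω ω' a b) :
    ω'.count Set.univ ∅ ≤ ω.count Set.univ {a, b} := by
  refine SimpleGraph.card_connectedComponent_le ?_
  rintro v w (hc | ⟨rfl, h1, h2⟩)
  · exact SimpleGraph.Adj.reachable (Or.inl hc)
  · simp only [Set.mem_insert_iff, Set.mem_singleton_iff, not_or] at h1 h2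
    refine SimpleGraph.Adj.reachable (Or.inr ⟨h.other v h1.1 h1.2 ?_ ?_, id, id⟩)
    · rintro rfl; exact h2.1 (ω.pair_pair a)
    · rintro rfl; exact h2.2 (ω.pair_pair b)

end WickContraction

/-! ### Removing a pair of vertices joined by color 0 -/

theorem nbr_ne (X : ColoredGraph d) (c : Fin d) (v : X.V) : X.nbr c v ≠ v := fun h => by
  have := X.side_nbr c v
  rw [h] at this
  cases hs : X.side v <;> simp [hs] at this

open Classical in
/-- Removal of two vertices `a` and `b` of opposite types, for each color joining together the
edges of that color incident to them. -/
noncomputable abbrev contract (X : ColoredGraph d) (a b : X.V) (h : X.side b = !X.side a) :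
    ColoredGraph d where
  V := {v : X.V // v ≠ a ∧ v ≠ b}
  finite := inferInstance
  side v := X.side v.1
  nbr c v :=
    if ha : X.nbr c v.1 = a then ⟨X.nbr c b, fun hb => v.2.2 (by
        rw [← X.nbr_nbr c v.1, ha, ← hb, X.nbr_nbr]), X.nbr_ne c b⟩
    else if hb : X.nbr c v.1 = b then ⟨X.nbr c a, X.nbr_ne c a, fun ha => v.2.1 (by
        rw [← X.nbr_nbr c v.1, hb, ← ha, X.nbr_nbr])⟩
    else ⟨X.nbr c v.1, ha, hb⟩
  nbr_nbr c v := by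
    have hab : a ≠ b := by
      rintro rfl
      cases hs : X.side a <;> simp [hs] at h
    obtain ⟨v, hva, hvb⟩ := v
    by_cases h1 : X.nbr c v = a
    · have : X.nbr c a = v := by rw [← h1, X.nbr_nbr]
      simp [h1, X.nbr_nbr, hab.symm, this]
    · by_cases h2 : X.nbr c v = b
      · have : X.nbr c b = v := by rw [← h2, X.nbr_nbr]
        simp [h2, X.nbr_nbr, hab.symm, this]
      · simp [h1, h2, X.nbr_nbr, hva, hvb]
  side_nbr c v := by
    have hab : a ≠ b := by
      rintro rfl
      cases hs : X.side a <;> simp [hs] at h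
    obtain ⟨v, hva, hvb⟩ := v
    have hs := X.side_nbr c v
    by_cases h1 : X.nbr c v = a
    · rw [h1] at hs
      simp [h1, X.side_nbr, h, hs]
    · by_cases h2 : X.nbr c v = b
      · rw [h2] at hs
        simp [h2, hab.symm, X.side_nbr, ← hs, h]
      · simp [h1, h2, hs]

section contract

variable {X : ColoredGraph d} {a b : X.V} {h : X.side b = !X.side a}

theorem contract_nbr_of_left {c : Fin d} {v : (X.contract a b h).V} (hv : X.nbr c v.1 = a) :
    ((X.contract a b h).nbr c v).1 = X.nbr c b := by
  simp [hv]

theorem contract_nbr_of_right {c : Fin d} {v : (X.contract a b h).V} (hv : X.nbr c v.1 = b) :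
    ((X.contract a b h).nbr c v).1 = X.nbr c a := by
  have hab : b ≠ a := by
    rintro rfl
    cases hs : X.side b <;> simp [hs] at h
  simp [hv, hab]

theorem contract_nbr_of_ne {c : Fin d} {v : (X.contract a b h).V} (hva : X.nbr c v.1 ≠ a)
    (hvb : X.nbr c v.1 ≠ b) : ((X.contract a b h).nbr c v).1 = X.nbr c v.1 := by
  simp [hva, hvb]

namespace WickContraction

/-- `ω` joins `a` and `b` by an edge of color 0 and agrees with `ω₀` at the other vertices. -/
structure Extends (ω : WickContraction X) (ω₀ : WickContraction (X.contract a b h)) : Prop where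
  pair_left : ω.pair a = b
  pair_val : ∀ v, ω.pair v.1 = (ω₀.pair v).1

theorem Extends.pair_right {ω : WickContraction X} {ω₀ : WickContraction (X.contract a b h)}
    (e : Extends ω ω₀) : ω.pair b = a := by rw [← e.pair_left, ω.pair_pair]

theorem exists_extends_of_pair (ω : WickContraction X) (hp : ω.pair a = b) :
    ∃ ω₀ : WickContraction (X.contract a b h), Extends ω ω₀ :=
  ⟨{ pair := fun v => ⟨ω.pair v.1,
        fun ha => v.2.2 (by rw [← ω.pair_pair v.1, ha, hp]),
        fun hb => v.2.1 (by rw [← ω.pair_pair v.1, hb, ← hp, ω.pair_pair])⟩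
     pair_pair := fun v => Subtype.ext (ω.pair_pair v.1)
     side_pair := fun v => ω.side_pair v.1 }, hp, fun _ => rfl⟩

theorem exists_extends (ω₀ : WickContraction (X.contract a b h)) :
    ∃ ω : WickContraction X, Extends ω ω₀ := by
  classical
  have hab : b ≠ a := by
    rintro rfl
    cases hs : X.side b <;> simp [hs] at h
  let p : X.V → X.V := fun v =>
    if ha : v = a then b else if hb : v = b then a else (ω₀.pair ⟨v, ha, hb⟩).1
  have pa : p a = b := by simp [p]
  have pb : p b = a := by simp [p, hab]
  have pv : ∀ v : (X.contract a b h).V, p v.1 = (ω₀.pair v).1 := fun v => by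
    simp [p, v.2.1, v.2.2]
  refine ⟨⟨p, fun v => ?_, fun v => ?_⟩, pa, pv⟩
  · by_cases ha : v = a
    · rw [ha, pa, pb]
    · by_cases hb : v = b
      · rw [hb, pb, pa]
      · have := pv ⟨v, ha, hb⟩
        simp only at this
        rw [this, pv, ω₀.pair_pair]
  · by_cases ha : v = a
    · rw [ha, pa, h]
    · by_cases hb : v = b
      · rw [hb, pb, h, Bool.not_not]
      · have := pv ⟨v, ha, hb⟩
        simp only at this
        rw [this]
        exact ω₀.side_pair ⟨v, ha, hb⟩

variable {ω : WickContraction X} {ω₀ : WickContraction (X.contract a b h)}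

open Classical in
/-- The map sending the removed vertices `a` and `b` to `w`. -/
noncomputable def retract (w : (X.contract a b h).V) (v : X.V) : (X.contract a b h).V :=
  if hv : v ≠ a ∧ v ≠ b then ⟨v, hv⟩ else w

theorem retract_val (w v : (X.contract a b h).V) : retract w v.1 = v := by
  have := v.2
  simp [retract, this.1, this.2]

theorem retract_left (w : (X.contract a b h).V) : retract w a = w := by simp [retract]

theorem retract_right (w : (X.contract a b h).V) : retract w b = w := by simp [retract]

namespace Extends

theorem val_reachable (e : Extends ω ω₀) (T : Set (Fin d)) (D : Set (X.contract a b h).V)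
    (v w : (X.contract a b h).V) (hvw : (ω₀.sub T D).Adj v w) :
    (ω.sub T (Subtype.val '' D)).Reachable v.1 w.1 := by
  have haD : a ∉ (Subtype.val '' D : Set X.V) := by rintro ⟨u, -, hu⟩; exact u.2.1 hu
  have hbD : b ∉ (Subtype.val '' D : Set X.V) := by rintro ⟨u, -, hu⟩; exact u.2.2 hu
  have hab : (ω.sub T (Subtype.val '' D)).Reachable a b := by
    have := ω.sub_pair T haD (by rwa [e.pair_left])
    rwa [e.pair_left] at this
  rcases hvw with ⟨c, hc, rfl⟩ | ⟨rfl, h1, h2⟩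
  · have hv := ω.sub_nbr (Subtype.val '' D) hc v.1
    by_cases ha : X.nbr c v.1 = a
    · rw [contract_nbr_of_left ha]
      rw [ha] at hv
      exact hv.trans (hab.trans (ω.sub_nbr _ hc b))
    · by_cases hb : X.nbr c v.1 = b
      · rw [contract_nbr_of_right hb]
        rw [hb] at hv
        exact hv.trans (hab.symm.trans (ω.sub_nbr _ hc a))
      · rw [contract_nbr_of_ne ha hb]
        exact hv
  · rw [← e.pair_val]
    refine ω.sub_pair T ?_ ?_
    · rintro ⟨u, hu, huv⟩
      exact h1 (Subtype.ext huv ▸ hu)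
    · rintro ⟨u, hu, huv⟩
      rw [e.pair_val] at huv
      exact h2 (Subtype.ext huv ▸ hu)

/-- The hypothesis `hw` is the bidipole shape: each color either joins `a` to `b` or joins `b` to
the single vertex `w`, so `a` and `b` can be collapsed onto `w`. -/
theorem retract_reachable (e : Extends ω ω₀) {w : (X.contract a b h).V}
    (hw : ∀ c, X.nbr c a = b ∨ X.nbr c b = w.1) (T : Set (Fin d))
    (D : Set (X.contract a b h).V) (u v : X.V)
    (huv : (ω.sub T (Subtype.val '' D)).Adj u v) :
    (ω₀.sub T D).Reachable (retract w u) (retract w v) := by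
  have key : ∀ (c : Fin d), c ∈ T → ∀ (z : (X.contract a b h).V),
      (ω₀.sub T D).Reachable z (retract w (X.nbr c z.1)) := by
    intro c hc z
    have hz := ω₀.sub_nbr D hc z
    by_cases ha : X.nbr c z.1 = a
    · have hb : X.nbr c b = w.1 := (hw c).resolve_left fun hb => z.2.2 (by
        rw [← X.nbr_nbr c z.1, ha, hb])
      rw [ha, retract_left]
      have : (X.contract a b h).nbr c z = w :=
        Subtype.ext ((contract_nbr_of_left ha).trans hb)
      rwa [this] at hz
    · by_cases hb : X.nbr c z.1 = b
      · have hb' : X.nbr c b = w.1 := (hw c).resolve_left fun ha' => z.2.1 (by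
          rw [← X.nbr_nbr c z.1, hb, ← ha', X.nbr_nbr])
        have : z = w := Subtype.ext
          ((X.nbr_nbr c z.1).symm.trans ((congrArg (X.nbr c) hb).trans hb'))
        rw [hb, retract_right, this]
      · have : X.nbr c z.1 = ((X.contract a b h).nbr c z).1 := (contract_nbr_of_ne ha hb).symm
        rwa [this, retract_val]
  rcases huv with ⟨c, hc, rfl⟩ | ⟨rfl, h1, h2⟩
  · by_cases hu : u ≠ a ∧ u ≠ b
    · have hr : retract w u = ⟨u, hu⟩ := retract_val w ⟨u, hu⟩
      rw [hr]
      exact key c hc ⟨u, hu⟩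
    · by_cases hn : X.nbr c u ≠ a ∧ X.nbr c u ≠ b
      · have := key c hc ⟨X.nbr c u, hn⟩
        simp only [X.nbr_nbr] at this
        have hr : retract w (X.nbr c u) = ⟨X.nbr c u, hn⟩ := retract_val w ⟨X.nbr c u, hn⟩
        rw [hr]
        exact this.symm
      · simp only [retract, hu, hn, dif_neg, not_false_iff]
        exact SimpleGraph.Reachable.refl _
  · by_cases hu : u ≠ a ∧ u ≠ b
    · have hp := e.pair_val ⟨u, hu⟩
      simp only at hp
      have hr : retract w u = ⟨u, hu⟩ := retract_val w ⟨u, hu⟩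
      rw [hp, retract_val, hr]
      refine ω₀.sub_pair T (fun hD => h1 ⟨_, hD, rfl⟩) (fun hD => h2 ⟨_, hD, hp.symm⟩)
    · rw [not_and_or, not_not, not_not] at hu
      rcases hu with rfl | rfl
      · rw [e.pair_left, retract_left, retract_right]
      · rw [e.pair_right, retract_left, retract_right]

/-- A color of `T` from `b` to `w`, with the 0-edge `a b`, puts both removed vertices in the
component of `w`; inclusion and retraction are then inverse on components. -/
theorem count_eq (e : Extends ω ω₀) {w : (X.contract a b h).V}
    (hw : ∀ c, X.nbr c a = b ∨ X.nbr c b = w.1) {T : Set (Fin d)}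
    (hT : ∃ c ∈ T, X.nbr c b = w.1) (D : Set (X.contract a b h).V) :
    ω.count T (Subtype.val '' D) = ω₀.count T D := by
  obtain ⟨c, hc, hcb⟩ := hT
  have hbw : (ω.sub T (Subtype.val '' D)).Reachable b w.1 := by
    rw [← hcb]; exact ω.sub_nbr _ hc b
  have hab : (ω.sub T (Subtype.val '' D)).Reachable a b := by
    have := ω.sub_pair T (S := Subtype.val '' D) (v := a)
      (by rintro ⟨u, -, hu⟩; exact u.2.1 hu)
      (by rw [e.pair_left]; rintro ⟨u, -, hu⟩; exact u.2.2 hu)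
    rwa [e.pair_left] at this
  refine Nat.card_congr
    { toFun := SimpleGraph.ConnectedComponent.mapOfAdjReachable _ (e.retract_reachable hw T D)
      invFun := SimpleGraph.ConnectedComponent.mapOfAdjReachable _ (e.val_reachable T D)
      left_inv := fun C => ?_
      right_inv := fun C => ?_ }
  · induction C using SimpleGraph.ConnectedComponent.ind with | _ v => ?_
    refine SimpleGraph.ConnectedComponent.sound ?_
    by_cases hv : v ≠ a ∧ v ≠ b
    · rw [show v = (⟨v, hv⟩ : (X.contract a b h).V).1 from rfl, retract_val]
    · rw [not_and_or, not_not, not_not] at hv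
      rcases hv with rfl | rfl
      · rw [retract_left]; exact (hab.trans hbw).symm
      · rw [retract_right]; exact hbw.symm
  · induction C using SimpleGraph.ConnectedComponent.ind with | _ v => ?_
    refine congrArg (SimpleGraph.connectedComponentMk _) ?_
    exact retract_val w v

/-- The edges of colors 0 and `c` between `a` and `b` form a cycle of length two, the one extra
component (`none` below). -/
theorem count_eq_add_one (e : Extends ω ω₀) {w : (X.contract a b h).V}
    (hw : ∀ c, X.nbr c a = b ∨ X.nbr c b = w.1) {c : Fin d} (hc : X.nbr c a = b) :
    ω.count {c} ∅ = ω₀.count {c} ∅ + 1 := by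
  have h1 := e.val_reachable {c} ∅
  have h2 := e.retract_reachable hw {c} ∅
  rw [Set.image_empty] at h1 h2
  have hab : (ω.sub {c} ∅).Reachable a b := by
    rw [← hc]; exact ω.sub_nbr _ (Set.mem_singleton c) a
  have closed : ∀ v u, (ω.sub {c} ∅).Reachable v u → (v = a ∨ v = b) → (u = a ∨ u = b) := by
    rintro v u ⟨p⟩
    induction p with
    | nil => exact id
    | cons hadj _ ih =>
      intro hv
      refine ih ?_
      rcases hadj with ⟨c', rfl, rfl⟩ | ⟨rfl, -, -⟩
      · rcases hv with rfl | rfl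
        · exact Or.inr hc
        · exact Or.inl (by rw [← hc, X.nbr_nbr])
      · rcases hv with rfl | rfl
        · exact Or.inr e.pair_left
        · exact Or.inl e.pair_right
  let ψ : Option (ω₀.sub {c} ∅).ConnectedComponent → (ω.sub {c} ∅).ConnectedComponent :=
    fun o => o.elim ((ω.sub {c} ∅).connectedComponentMk a)
      (SimpleGraph.ConnectedComponent.mapOfAdjReachable _ h1)
  have hψ : Function.Bijective ψ := by
    have hna : ∀ v : (X.contract a b h).V, ¬ (ω.sub {c} ∅).Reachable a v.1 := fun v hr =>
      (closed _ _ hr (Or.inl rfl)).elim v.2.1 v.2.2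
    constructor
    · rintro (_ | C) (_ | D) hCD
      · rfl
      · induction D using SimpleGraph.ConnectedComponent.ind with | _ v => ?_
        exact absurd (SimpleGraph.ConnectedComponent.exact hCD) (hna v)
      · induction C using SimpleGraph.ConnectedComponent.ind with | _ v => ?_
        exact absurd (SimpleGraph.ConnectedComponent.exact hCD.symm) (hna v)
      · induction C using SimpleGraph.ConnectedComponent.ind with | _ v => ?_
        induction D using SimpleGraph.ConnectedComponent.ind with | _ u => ?_
        have hr : (ω.sub {c} ∅).Reachable v.1 u.1 := SimpleGraph.ConnectedComponent.exact hCD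
        have := hr.of_adj_reachable _ h2
        rw [retract_val, retract_val] at this
        exact congrArg some (SimpleGraph.ConnectedComponent.sound this)
    · intro C
      induction C using SimpleGraph.ConnectedComponent.ind with | _ v => ?_
      by_cases hv : v ≠ a ∧ v ≠ b
      · exact ⟨some ((ω₀.sub {c} ∅).connectedComponentMk ⟨v, hv⟩), rfl⟩
      · refine ⟨none, SimpleGraph.ConnectedComponent.sound ?_⟩
        rw [not_and_or, not_not, not_not] at hv
        rcases hv with rfl | rfl
        · exact SimpleGraph.Reachable.refl _
        · exact hab
  rw [count, count, ← Nat.card_congr (Equiv.ofBijective ψ hψ), Finite.card_option]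

open Classical in
theorem numCycles_eq (e : Extends ω ω₀) {w : (X.contract a b h).V}
    (hw : ∀ c, X.nbr c a = b ∨ X.nbr c b = w.1) :
    ω.numCycles = ω₀.numCycles + ∑ c : Fin d, if X.nbr c a = b then 1 else 0 := by
  rw [WickContraction.numCycles_eq, WickContraction.numCycles_eq, ← Finset.sum_add_distrib]
  refine Finset.sum_congr rfl fun c _ => ?_
  split_ifs with hc
  · exact e.count_eq_add_one hw hc
  · have := e.count_eq hw (T := {c}) ⟨c, rfl, (hw c).resolve_left hc⟩ ∅
    rwa [Set.image_empty] at this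

theorem isPenalizedMax (e : Extends ω ω₀) {w : (X.contract a b h).V}
    (hw : ∀ c, X.nbr c a = b ∨ X.nbr c b = w.1) (hne : ∃ c, X.nbr c b = w.1)
    (hω : ω.IsPenalizedMax) : ω₀.IsPenalizedMax := by
  intro ω₀'
  obtain ⟨ω', e'⟩ := exists_extends ω₀'
  obtain ⟨c, hc⟩ := hne
  have h1 := hω ω'
  have hK := e.count_eq hw (T := Set.univ) ⟨c, trivial, hc⟩ ∅
  have hK' := e'.count_eq hw (T := Set.univ) ⟨c, trivial, hc⟩ ∅
  rw [Set.image_empty] at hK hK'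
  rw [e.numCycles_eq hw, e'.numCycles_eq hw, hK, hK'] at h1
  omega

end Extends

end WickContraction

end contract

/-! ### Induction on bidipole insertions -/

/-- For every embedding of `B` in a colored graph with a contraction that is maximal in the
penalized sense, the pairs of `π` are joined by an edge of color 0 or the deletion of the two edges
of color 0 at these vertices increases the number of components. -/
def IsCutPairing {B : ColoredGraph d} (π : WickContraction B) : Prop :=
  ∀ (Z : ColoredGraph d) (f : B.V → Z.V), Function.Injective f →
    (∀ v, Z.side (f v) = B.side v) → (∀ c v, Z.nbr c (f v) = f (B.nbr c v)) →
    ∀ G : WickContraction Z, G.IsPenalizedMax → ∀ v, G.pair (f v) = f (π.pair v) ∨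
      G.count Set.univ ∅ < G.count Set.univ {f v, f (π.pair v)}

/-- The pairing of the bubble with two vertices. -/
def twoVertexPairing (d : ℕ) : WickContraction (twoVertex d) where
  pair v := !v
  pair_pair v := Bool.not_not v
  side_pair _ := rfl

theorem isCutPairing_twoVertex (hd : 0 < d) : IsCutPairing (twoVertexPairing d) := by
  intro Z f _ hside hnbr G hG v
  by_cases hp : G.pair (f v) = f (!v)
  · exact Or.inl hp
  right
  obtain ⟨G', hsw⟩ := G.exists_switch
    ((hside (!v)).trans (congrArg not (hside v).symm)) hp
  have := (hsw.isPenalizedMax hG ∅ (by simpa using hd) fun c _ => hnbr c v).1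
  exact lt_of_lt_of_le (by omega) hsw.count_deleteAt_ends

/-- Transport of a contraction along an isomorphism of colored graphs. -/
def WickContraction.transport {X Y : ColoredGraph d} (π : WickContraction X) (e : X.V ≃ Y.V)
    (he : ∀ v, Y.side (e v) = X.side v) : WickContraction Y where
  pair v := e (π.pair (e.symm v))
  pair_pair v := by simp [π.pair_pair]
  side_pair v := by
    rw [he, π.side_pair, ← he, e.apply_symm_apply]

theorem IsCutPairing.transport {X Y : ColoredGraph d} {π : WickContraction X}
    (hπ : IsCutPairing π) (e : X.V ≃ Y.V) (he : ∀ v, Y.side (e v) = X.side v)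
    (hn : ∀ c v, e (X.nbr c v) = Y.nbr c (e v)) : IsCutPairing (π.transport e he) := by
  intro Z f hf hside hnbr G hG v
  have := hπ Z (f ∘ e) (hf.comp e.injective) (fun v => by simp [hside, he])
    (fun c v => by simp [hnbr, hn]) G hG (e.symm v)
  simpa [WickContraction.transport] using this

/-- The pairing of `X.insertBidipole x C` that joins the two new vertices to each other. -/
noncomputable def WickContraction.insertPair {X : ColoredGraph d} (π : WickContraction X)
    (x : X.V) (C : Finset (Fin d)) : WickContraction (X.insertBidipole x C) where
  pair := Sum.map π.pair (fun t => !t)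
  pair_pair v := by
    rcases v with v | t
    · exact congrArg Sum.inl (π.pair_pair v)
    · exact congrArg Sum.inr (Bool.not_not t)
  side_pair v := by
    rcases v with v | t
    · exact π.side_pair v
    · cases t <;> simp [insertBidipole]

theorem insertBidipole_connected {X : ColoredGraph d} (hX : X.graph.Connected) (x : X.V)
    {C : Finset (Fin d)} (hC : C.Nonempty) (hC' : ∃ c, c ∉ C) :
    (X.insertBidipole x C).graph.Connected := by
  obtain ⟨c, hc⟩ := hC
  obtain ⟨c', hc'⟩ := hC'
  have adj : ∀ c v, (X.insertBidipole x C).graph.Reachable v ((X.insertBidipole x C).nbr c v) :=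
    fun c v => SimpleGraph.Adj.reachable ⟨c, rfl⟩
  have h1 : (X.insertBidipole x C).graph.Reachable (Sum.inr false) (Sum.inl x) := by
    have := adj c (Sum.inr false)
    simpa [insertBidipole, hc] using this
  have h2 : (X.insertBidipole x C).graph.Reachable (Sum.inr true) (Sum.inr false) := by
    have := adj c' (Sum.inr true)
    simpa [insertBidipole, hc'] using this
  have h3 : ∀ v w, X.graph.Adj v w →
      (X.insertBidipole x C).graph.Reachable (Sum.inl v) (Sum.inl w) := by
    have h4 : ∀ c ∈ C, (X.insertBidipole x C).graph.Reachable (Sum.inl x)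
        (Sum.inl (X.nbr c x)) := by
      intro c hc
      have := adj c (Sum.inr true)
      simp only [insertBidipole, hc, Sum.elim_inr, if_true] at this
      exact h1.symm.trans (h2.symm.trans this)
    rintro v _ ⟨c, rfl⟩
    by_cases hc : c ∈ C
    · by_cases hv : v = x
      · rw [hv]; exact h4 c hc
      · by_cases hv' : X.nbr c v = x
        · have := h4 c hc
          have hx : X.nbr c x = v := by rw [← hv', X.nbr_nbr]
          rw [hx] at this
          rw [hv']
          exact this.symm
        · simpa [insertBidipole, hc, hv, hv'] using adj c (Sum.inl v)
    · simpa [insertBidipole, hc] using adj c (Sum.inl v)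
  have h5 : ∀ v, (X.insertBidipole x C).graph.Reachable v (Sum.inl x) := by
    rintro (v | _ | _)
    · exact (hX.preconnected v x).of_adj_reachable Sum.inl h3
    · exact h1
    · exact h2.trans h1
  exact SimpleGraph.connected_iff _ |>.2 ⟨fun v w => (h5 v).trans (h5 w).symm, ⟨Sum.inl x⟩⟩

theorem IsCutPairing.insertPair {X : ColoredGraph d} {π : WickContraction X}
    (hπ : IsCutPairing π) (x : X.V) {C : Finset (Fin d)} (hC : C.Nonempty)
    (hCd : 2 * C.card < d) : IsCutPairing (π.insertPair x C) := by
  classical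
  intro Z f hf hside hnbr G hG
  set a := f (Sum.inr true) with ha
  set b := f (Sum.inr false) with hb
  have hopp : Z.side b = !Z.side a :=
    (hside (Sum.inr false)).trans (congrArg not (hside (Sum.inr true)).symm)
  have hab : ∀ c ∉ C, Z.nbr c a = b := fun c hc =>
    (hnbr c (Sum.inr true)).trans (congrArg f (by simp [insertBidipole, hc]))
  obtain ⟨c₁, hc₁⟩ : ∃ c, c ∉ C := by
    by_contra! hall
    rw [Finset.eq_univ_iff_forall.2 hall, Finset.card_univ, Fintype.card_fin] at hCd
    omega
  have hfa : ∀ y, f (Sum.inl y) ≠ a := fun y h => by simpa using hf h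
  have hfb : ∀ y, f (Sum.inl y) ≠ b := fun y h => by simpa using hf h
  have hCb : ∀ c ∈ C, Z.nbr c b = f (Sum.inl x) := fun c hc =>
    (hnbr c (Sum.inr false)).trans (congrArg f (by simp [insertBidipole, hc]))
  have hCa : ∀ c ∈ C, Z.nbr c a = f (Sum.inl (X.nbr c x)) := fun c hc =>
    (hnbr c (Sum.inr true)).trans (congrArg f (by simp [insertBidipole, hc]))
  let f₀ : X.V → (Z.contract a b hopp).V := fun y => ⟨f (Sum.inl y), hfa y, hfb y⟩
  have hf₀ : Function.Injective f₀ := fun y z h =>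
    Sum.inl_injective (hf (congrArg Subtype.val h))
  have hnbr₀ : ∀ c y, (Z.contract a b hopp).nbr c (f₀ y) = f₀ (X.nbr c y) := by
    intro c y
    refine Subtype.ext ?_
    have hy : Z.nbr c (f₀ y).1 = f ((X.insertBidipole x C).nbr c (Sum.inl y)) := hnbr c _
    by_cases hc : c ∈ C
    · by_cases hyx : y = x
      · have hy' : Z.nbr c (f₀ y).1 = b := by rw [hy]; simp [insertBidipole, hc, hyx, hb]
        rw [contract_nbr_of_right hy', hCa c hc, hyx]
      · by_cases hyx' : X.nbr c y = x
        · have hy' : Z.nbr c (f₀ y).1 = a := by rw [hy]; simp [insertBidipole, hc, hyx, hyx', ha]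
          rw [contract_nbr_of_left hy', hCb c hc, hyx']
        · have hy' : Z.nbr c (f₀ y).1 = f (Sum.inl (X.nbr c y)) := by
            rw [hy]; simp [insertBidipole, hc, hyx, hyx']
          rw [contract_nbr_of_ne (by rw [hy']; exact hfa _) (by rw [hy']; exact hfb _), hy']
    · have hy' : Z.nbr c (f₀ y).1 = f (Sum.inl (X.nbr c y)) := by
        rw [hy]; simp [insertBidipole, hc]
      rw [contract_nbr_of_ne (by rw [hy']; exact hfa _) (by rw [hy']; exact hfb _), hy']
  have hw : ∀ c, Z.nbr c a = b ∨ Z.nbr c b = (f₀ x).1 := fun c => by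
    by_cases hc : c ∈ C
    · exact Or.inr (hCb c hc)
    · exact Or.inl (hab c hc)
  have hne : ∃ c, Z.nbr c b = (f₀ x).1 := hC.imp hCb
  -- With `a b` an edge of color 0, removing it leaves a copy of `X` in a smaller ambient graph, and
  -- both counts in the cut condition are unchanged.
  have descend : ∀ G' : WickContraction Z, G'.IsPenalizedMax → G'.pair a = b → ∀ y : X.V,
      G'.pair (f (Sum.inl y)) = f (Sum.inl (π.pair y)) ∨ G'.count Set.univ ∅ <
        G'.count Set.univ {f (Sum.inl y), f (Sum.inl (π.pair y))} := by
    intro G' hG' hp y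
    obtain ⟨G₀, e⟩ := G'.exists_extends_of_pair (h := hopp) hp
    have := hπ _ f₀ hf₀ (fun y => hside (Sum.inl y)) hnbr₀ G₀ (e.isPenalizedMax hw hne hG') y
    obtain ⟨c, hc⟩ := hne
    have hK := e.count_eq hw (T := Set.univ) ⟨c, trivial, hc⟩ ∅
    have hK' := e.count_eq hw (T := Set.univ) ⟨c, trivial, hc⟩ {f₀ y, f₀ (π.pair y)}
    rw [Set.image_empty] at hK
    rw [Set.image_pair] at hK'
    refine this.imp (fun h => ?_) fun h => ?_
    · exact (e.pair_val (f₀ y)).trans (congrArg Subtype.val h)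
    · rw [hK]; exact h.trans_eq hK'.symm
  by_cases hp : G.pair a = b
  · rintro (y | _ | _)
    · exact descend G hG hp y
    · exact Or.inl (by rw [← hb, ← hp, G.pair_pair]; rfl)
    · exact Or.inl hp
  · obtain ⟨G', hsw⟩ := G.exists_switch hopp hp
    obtain ⟨hK, hG'⟩ := hsw.isPenalizedMax hG C hCd hab
    have hcut : G.count Set.univ ∅ < G.count Set.univ {a, b} :=
      lt_of_lt_of_le (by omega) hsw.count_deleteAt_ends
    rintro (y | _ | _)
    · change G.pair (f (Sum.inl y)) = f (Sum.inl (π.pair y)) ∨ G.count Set.univ ∅ <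
        G.count Set.univ {f (Sum.inl y), f (Sum.inl (π.pair y))}
      rcases descend G' hG' hsw.left y with h | h
      -- The pair joined in `G'` may be the edge created between the old partners of `a` and `b`; in
      -- `G` the two 0-edges at this pair are those at `a` and `b`, hence a cut.
      · by_cases h3 : f (Sum.inl y) = G.pair a
        · right
          rw [← h, h3, hsw.right]
          have := hsw.dual.count_deleteAt_ends
          omega
        · by_cases h4 : f (Sum.inl y) = G.pair b
          · right
            rw [← h, h4, hsw.right']
            have := hsw.symm.dual.count_deleteAt_ends
            omega
          · left
            rw [← hsw.other _ (hfa y) (hfb y) h3 h4, h]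
      · right
        -- Going back to `G` lowers the count after deletion by at most one, and the count without
        -- deletion by exactly one (`hK`), so the strict inequality survives.
        have := hsw.count_univ_le_add_one (hab c₁ hc₁)
          (D := {f (Sum.inl y), f (Sum.inl (π.pair y))})
          (by simp [(hfa _).symm]) (by simp [(hfb _).symm])
        omega
    · right
      change G.count Set.univ ∅ < G.count Set.univ {b, a}
      rwa [Set.pair_comm]
    · exact Or.inr hcut

theorem Iso.connected {X Y : ColoredGraph d} (h : X.Iso Y) (hX : X.graph.Connected) :
    Y.graph.Connected := by
  obtain ⟨e, -, hn⟩ := h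
  have hne := hX.nonempty
  refine SimpleGraph.connected_iff _ |>.2 ⟨fun v w => ?_, hne.map e⟩
  have := (hX.preconnected (e.symm v) (e.symm w)).of_adj_reachable (H' := Y.graph) e (by
    rintro v _ ⟨c, rfl⟩
    exact SimpleGraph.Adj.reachable ⟨c, (hn c v).symm⟩)
  simpa using this

theorem GMBuild.connected_and_exists_isCutPairing (hd : 0 < d) {B : ColoredGraph d}
    {𝒞 : Multiset (Finset (Fin d))} (hB : GMBuild B 𝒞) (h𝒞 : ∀ C ∈ 𝒞, 2 * C.card < d) :
    B.graph.Connected ∧ ∃ π : WickContraction B, IsCutPairing π := by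
  induction hB with
  | base =>
    refine ⟨?_, _, isCutPairing_twoVertex hd⟩
    have key : ∀ v : Bool, (twoVertex d).graph.Reachable v (!v) :=
      fun v => SimpleGraph.Adj.reachable ⟨⟨0, hd⟩, rfl⟩
    refine SimpleGraph.connected_iff _ |>.2 ⟨fun v w => ?_, ⟨true⟩⟩
    rcases Bool.eq_or_eq_not w v with rfl | rfl
    · exact SimpleGraph.Reachable.refl _
    · exact key v
  | insert X 𝒞 x C _ hC ih =>
    obtain ⟨hX, π, hπ⟩ := ih fun C hC => h𝒞 C (Multiset.mem_cons_of_mem hC)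
    have hCd := h𝒞 C (Multiset.mem_cons_self C 𝒞)
    refine ⟨insertBidipole_connected hX x hC.1 ?_, _, hπ.insertPair x hC.1 hCd⟩
    by_contra! hall
    rw [Finset.eq_univ_iff_forall.2 hall, Finset.card_univ, Fintype.card_fin] at hCd
    omega
  | iso X Y 𝒞 _ hiso ih =>
    obtain ⟨hX, π, hπ⟩ := ih h𝒞
    refine ⟨hiso.connected hX, ?_⟩
    obtain ⟨e, he, hn⟩ := hiso
    exact ⟨_, hπ.transport e he hn⟩

/-! ### Maximality of the pairing and conclusion -/

instance (X : ColoredGraph d) : Finite (WickContraction X) :=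
  Finite.of_injective WickContraction.pair fun _ _ h => WickContraction.ext_pair (congrFun h)

theorem deleteAt_connected {B : ColoredGraph d} (hB : B.graph.Connected) (ω : WickContraction B)
    (S : Set B.V) : (ω.deleteAt S).Connected :=
  hB.mono fun _ _ h => Or.inl h

theorem IsCutPairing.isMax [NeZero d] {B : ColoredGraph d} (hB : B.graph.Connected)
    {π : WickContraction B} (hπ : IsCutPairing π) : π.IsMax := by
  have : Nonempty (WickContraction B) := ⟨π⟩
  obtain ⟨ω, hω⟩ := Finite.exists_max fun ω : WickContraction B => ω.numCycles
  have hmax : ω.IsMax := ⟨deleteAt_connected hB ω ∅, fun ω' _ => hω ω'⟩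
  have hcount : ∀ S, ω.count Set.univ S = 1 := fun S => by
    have := (SimpleGraph.connected_iff_card _).1 (deleteAt_connected hB ω S)
    rwa [WickContraction.deleteAt_eq_sub] at this
  -- With `B` as its own ambient graph, connectedness of `B` rules out the cut alternative at every
  -- vertex.
  have : ω = π := WickContraction.ext_pair fun v =>
    (hπ B id Function.injective_id (fun _ => rfl) (fun _ _ => rfl) ω
      hmax.isPenalizedMax v).resolve_right (by rw [hcount, hcount]; exact lt_irrefl 1)
  rwa [← this]

end ColoredGraph

theorem mainTheorem6 {d : ℕ} (hd : 2 < d) {R : Type} [Finite R]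
    (Br : R → ColoredGraph d) (hBr : ∀ r, (Br r).IsBubble) (b : R → ℕ)
    (B : ColoredGraph d) (hB : B.IsTotallyUnbalancedGM)
    (G : ColoredGraph.WickContraction (ColoredGraph.withMarked B Br b)) (hG : G.IsMax) :
    ColoredGraph.MaximalTwoCut G := by
  have : NeZero d := ⟨by omega⟩
  obtain ⟨𝒞, hbuild, h𝒞⟩ := hB
  obtain ⟨hcon, π, hπ⟩ := hbuild.connected_and_exists_isCutPairing (by omega) h𝒞
  refine ⟨π, hπ.isMax hcon, fun v => ?_⟩
  refine (hπ _ Sum.inl Sum.inl_injective (fun _ => rfl) (fun _ _ => rfl) G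
    hG.isPenalizedMax v).imp_right fun h hc => ?_
  rw [(ColoredGraph.WickContraction.isConnected_iff G).1 hG.1] at h
  rw [ColoredGraph.WickContraction.deleteAt_eq_sub,
    SimpleGraph.connected_iff_card] at hc
  exact h.ne' hc
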